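/- For $0\le k<1$ let $K(k)=\int_0^{\pi/2}\frac{d\theta}{\sqrt{1-k^2\sin^2\theta}}$ be the complete elliptic integral of the first kind with modulus $k$. Let $r>0$ and $q=e^{-\pi\sqrt r}$. Then there is exactly one $k_r\in(0,1)$ with $\frac{K\left(\sqrt{1-k_r^2}\right)}{K(k_r)}=\sqrt r$ and, writing $K=K(k_r)$, both series below converge absolutely and $$2\sum_{\substack{n\ge 0\\ n\ \mathrm{odd}}}\frac{(-1)^{\frac{n-1}{2}}q^{n/2}}{1-q^n}=\sum_{n=0}^{\infty}\frac{(-1)^n}{\sinh\left(\left(n+\tfrac12\right)\pi\sqrt r\right)}=\frac{K\,k_r}{\pi}.$$ -/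

import Mathlib

/-- The complete elliptic integral of the first kind, as a function of the modulus `k`
(intended for `0 ≤ k < 1`):
`K(k) = ∫ θ in 0..π/2, 1 / √(1 - k² sin² θ)`. -/
noncomputable def ellipticK (k : ℝ) : ℝ :=
  ∫ θ in (0 : ℝ)..(Real.pi / 2), 1 / Real.sqrt (1 - k ^ 2 * Real.sin θ ^ 2)

/-- `k` is the elliptic modulus `k_r` belonging to `r`: it lies in `(0, 1)` and
`K' / K = √r`, where `K = K(k)` and `K' = K(k')` with `k' = √(1 - k²)` the complementary
modulus. -/
def IsModulusOf (r k : ℝ) : Prop :=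
  0 < k ∧ k < 1 ∧ ellipticK (Real.sqrt (1 - k ^ 2)) / ellipticK k = Real.sqrt r

open Real Filter Topology

/-! Put `s = π√r`, `L = sechSum 0 s`, `M = altSechSum s`, `N = sechSum (1/2) s`; classically these
are the squares of the theta constants θ₃, θ₄, θ₂ at nome `e^{-s}`. The modulus is exhibited
explicitly as `k = N / L`.

Two facts about the sums suffice. The relation `L² = M² + N²` (`sechSum_zero_sq`) makes `M / L` the
complementary modulus. The duplication formulas `L(s) ± M(s) = 2L(2s), 2N(2s)` then say that `s ↦
2s` is an arithmetic-geometric mean step on `(L, M)`, and that a mean step takes `(L(2s), N(2s))` to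
`(L(s), N(s)) / 2`. Gauss's integral `I` is invariant under the step (`gaussIntegral_landen`).
Iterating, `L, M → 1` gives `I(L, M) = π/2`, while `I(L, N)` doubles with `s` and the logarithmic
asymptotics of `I(a, b)` as `b → 0` give `I(L, N) = s/2`. By homogeneity `K(k) = Lπ/2` and `K(k') =
Ls/2`, whose ratio is `√r`; uniqueness holds because `K` is strictly increasing.

Hence `K k / π = N / 2`, and expanding each `sech` geometrically and exchanging summations
(`hasSum_alt_div_sinh`) identifies `N / 2` with the alternating `1 / sinh` series. -/

/-- Gauss's form `∫₀^{π/2} dθ / √(a² cos² θ + b² sin² θ)` of the complete elliptic integral. -/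
noncomputable def gaussIntegral (a b : ℝ) : ℝ :=
  ∫ θ in (0 : ℝ)..(π / 2), (√(a ^ 2 * cos θ ^ 2 + b ^ 2 * sin θ ^ 2))⁻¹

/-! ### Elementary properties of Gauss's integral -/

lemma gauss_quadratic_pos {a b : ℝ} (ha : 0 < a) (hb : 0 < b) (θ : ℝ) :
    0 < a ^ 2 * cos θ ^ 2 + b ^ 2 * sin θ ^ 2 := by
  have h := sin_sq_add_cos_sq θ
  rcases eq_or_ne (sin θ) 0 with h0 | h0
  · have : cos θ ^ 2 = 1 := by rw [h0] at h; linarith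
    rw [this, h0]; positivity
  · positivity

lemma continuous_gauss_integrand {a b : ℝ} (ha : 0 < a) (hb : 0 < b) :
    Continuous fun θ : ℝ => (√(a ^ 2 * cos θ ^ 2 + b ^ 2 * sin θ ^ 2))⁻¹ := by
  refine Continuous.inv₀ (by fun_prop) fun θ => ?_
  exact (sqrt_pos.2 (gauss_quadratic_pos ha hb θ)).ne'

lemma gaussIntegral_mul {c : ℝ} (hc : 0 < c) (a b : ℝ) :
    gaussIntegral (c * a) (c * b) = gaussIntegral a b / c := by
  unfold gaussIntegral
  rw [← intervalIntegral.integral_div]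
  congr 1
  funext θ
  rw [show (c * a) ^ 2 * cos θ ^ 2 + (c * b) ^ 2 * sin θ ^ 2
      = c ^ 2 * (a ^ 2 * cos θ ^ 2 + b ^ 2 * sin θ ^ 2) by ring,
    sqrt_mul (by positivity), sqrt_sq hc.le, mul_inv, div_eq_mul_inv, mul_comm]

lemma gaussIntegral_comm (a b : ℝ) : gaussIntegral a b = gaussIntegral b a := by
  unfold gaussIntegral
  have h := intervalIntegral.integral_comp_sub_left (a := 0) (b := π / 2)
    (fun θ : ℝ => (√(a ^ 2 * cos θ ^ 2 + b ^ 2 * sin θ ^ 2))⁻¹) (π / 2)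
  simp only [sub_self, sub_zero, cos_pi_div_two_sub, sin_pi_div_two_sub] at h
  rw [← h]
  congr 1
  funext θ
  rw [add_comm]

lemma integral_zero_pi_gauss {a b : ℝ} (ha : 0 < a) (hb : 0 < b) :
    ∫ θ in (0 : ℝ)..π, (√(a ^ 2 * cos θ ^ 2 + b ^ 2 * sin θ ^ 2))⁻¹ = 2 * gaussIntegral a b := by
  have hc := continuous_gauss_integrand ha hb
  rw [← intervalIntegral.integral_add_adjacent_intervals
    (hc.intervalIntegrable 0 (π / 2)) (hc.intervalIntegrable (π / 2) π)]
  have h := intervalIntegral.integral_comp_sub_left (a := 0) (b := π / 2)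
    (fun θ : ℝ => (√(a ^ 2 * cos θ ^ 2 + b ^ 2 * sin θ ^ 2))⁻¹) π
  simp only [sub_zero, cos_pi_sub, sin_pi_sub, neg_sq] at h
  rw [show π - π / 2 = π / 2 by ring] at h
  rw [← h, gaussIntegral]
  ring

/-! ### The Landen transformation -/

lemma landen_denominator_pos {a b : ℝ} (ha : 0 < a) (hb : 0 < b) (θ : ℝ) :
    0 < a * cos θ ^ 2 + b * sin θ ^ 2 := by
  have := gauss_quadratic_pos (sqrt_pos.2 ha) (sqrt_pos.2 hb) θ
  rwa [sq_sqrt ha.le, sq_sqrt hb.le] at this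

lemma one_add_landen_tan_sq {a b : ℝ} (ha : 0 < a) (hb : 0 < b) (θ : ℝ) :
    1 + ((a - b) * (sin θ * cos θ) / (a * cos θ ^ 2 + b * sin θ ^ 2)) ^ 2
      = (a ^ 2 * cos θ ^ 2 + b ^ 2 * sin θ ^ 2) / (a * cos θ ^ 2 + b * sin θ ^ 2) ^ 2 := by
  have hE := landen_denominator_pos ha hb θ
  field_simp
  linear_combination (a ^ 2 * cos θ ^ 2 + b ^ 2 * sin θ ^ 2) * sin_sq_add_cos_sq θ

/-- The substitution is `φ = θ + arctan ((b / a) tan θ)`, rewritten so that it stays smooth at `θ =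
π/2`. It carries `[0, π/2]` onto `[0, π]`, which accounts for the factor 2 in
`gaussIntegral_landen`. -/
lemma hasDerivAt_landen_angle {a b : ℝ} (ha : 0 < a) (hb : 0 < b) (θ : ℝ) :
    HasDerivAt (fun θ => 2 * θ - arctan ((a - b) * (sin θ * cos θ)
        / (a * cos θ ^ 2 + b * sin θ ^ 2)))
      ((a + b) * (a * cos θ ^ 2 + b * sin θ ^ 2) / (a ^ 2 * cos θ ^ 2 + b ^ 2 * sin θ ^ 2)) θ := by
  have hD := gauss_quadratic_pos ha hb θ
  have hE := landen_denominator_pos ha hb θ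
  have hs := hasDerivAt_sin θ
  have hc := hasDerivAt_cos θ
  have key := ((hasDerivAt_id θ).const_mul 2).sub ((((hs.mul hc).const_mul (a - b)).div
    (((hc.pow 2).const_mul a).add ((hs.pow 2).const_mul b)) hE.ne').arctan)
  refine key.congr_deriv ?_
  simp only [Pi.mul_apply, Pi.pow_apply, Pi.add_apply, Pi.div_apply]
  rw [one_add_landen_tan_sq ha hb]
  have h1 : cos θ ^ 2 = 1 - sin θ ^ 2 := by linarith [sin_sq_add_cos_sq θ]
  have h2 : cos θ ^ 4 = (1 - sin θ ^ 2) ^ 2 := by rw [← h1]; ring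
  field_simp
  ring_nf
  simp only [h1, h2]
  ring

lemma landen_quadratic {a b : ℝ} (ha : 0 < a) (hb : 0 < b) (θ : ℝ) :
    ((a + b) / 2) ^ 2 * cos (2 * θ - arctan ((a - b) * (sin θ * cos θ)
        / (a * cos θ ^ 2 + b * sin θ ^ 2))) ^ 2
      + √(a * b) ^ 2 * sin (2 * θ - arctan ((a - b) * (sin θ * cos θ)
        / (a * cos θ ^ 2 + b * sin θ ^ 2))) ^ 2
    = ((a + b) / 2 * (a * cos θ ^ 2 + b * sin θ ^ 2)) ^ 2
      / (a ^ 2 * cos θ ^ 2 + b ^ 2 * sin θ ^ 2) := by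
  have hD := gauss_quadratic_pos ha hb θ
  have hE := landen_denominator_pos ha hb θ
  have h1 := sin_sq_add_cos_sq θ
  rw [sq_sqrt (by positivity), cos_sub, sin_sub, cos_arctan, sin_arctan, cos_two_mul, sin_two_mul,
    one_add_landen_tan_sq ha hb, sqrt_div hD.le, sqrt_sq hE.le]
  have hD' := sq_sqrt hD.le
  have hDp := sqrt_pos.2 hD
  generalize √(a ^ 2 * cos θ ^ 2 + b ^ 2 * sin θ ^ 2) = R at *
  rw [← hD']
  obtain ⟨E, hEdef⟩ : ∃ E, E = a * cos θ ^ 2 + b * sin θ ^ 2 := ⟨_, rfl⟩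
  rw [← hEdef] at hE ⊢
  have hC : (2 * cos θ ^ 2 - 1) * (1 / (R / E))
      + 2 * sin θ * cos θ * ((a - b) * (sin θ * cos θ) / E / (R / E))
      = (a * cos θ ^ 2 - b * sin θ ^ 2) / R := by
    field_simp
    rw [hEdef]
    linear_combination (2 * a * cos θ ^ 2) * h1
  have hS : 2 * sin θ * cos θ * (1 / (R / E))
      - (2 * cos θ ^ 2 - 1) * ((a - b) * (sin θ * cos θ) / E / (R / E))
      = (a + b) * (sin θ * cos θ) / R := by
    field_simp
    rw [hEdef]
    linear_combination (2 * b * sin θ * cos θ) * h1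
  rw [hC, hS]
  field_simp
  rw [hEdef]
  ring

/-- Invariance of Gauss's integral under the arithmetic-geometric mean step. -/
theorem gaussIntegral_landen {a b : ℝ} (ha : 0 < a) (hb : 0 < b) :
    gaussIntegral ((a + b) / 2) (√(a * b)) = gaussIntegral a b := by
  have hA : 0 < (a + b) / 2 := by positivity
  have hB : 0 < √(a * b) := sqrt_pos.2 (by positivity)
  have h := intervalIntegral.integral_comp_mul_deriv (a := 0) (b := π / 2)
    (fun θ _ => hasDerivAt_landen_angle ha hb θ)
    (Continuous.continuousOn <| Continuous.div (by fun_prop) (by fun_prop)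
      fun θ => (gauss_quadratic_pos ha hb θ).ne')
    (continuous_gauss_integrand hA hB)
  simp only [Function.comp_apply, landen_quadratic ha hb, sin_zero, cos_pi_div_two, mul_zero,
    zero_mul, zero_div, arctan_zero, sub_zero, mul_div_cancel₀ π (two_ne_zero (α := ℝ))] at h
  rw [integral_zero_pi_gauss hA hB] at h
  have h2 : 2 * gaussIntegral a b = 2 * gaussIntegral ((a + b) / 2) (√(a * b)) := by
    rw [← h, gaussIntegral, ← intervalIntegral.integral_const_mul]
    congr 1
    funext θ
    have hD := gauss_quadratic_pos ha hb θ
    have hE := landen_denominator_pos ha hb θ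
    rw [sqrt_div (by positivity), sqrt_sq (by positivity)]
    have hDp := sqrt_pos.2 hD
    have hD' := sq_sqrt hD.le
    generalize √(a ^ 2 * cos θ ^ 2 + b ^ 2 * sin θ ^ 2) = R at *
    rw [← hD']
    field_simp
  linarith

/-! ### Bounds for Gauss's integral -/

lemma gaussIntegral_bounds {a b : ℝ} (hb : 0 < b) (hab : b ≤ a) :
    π / 2 / a ≤ gaussIntegral a b ∧ gaussIntegral a b ≤ π / 2 / b := by
  have ha := hb.trans_le hab
  have hc := continuous_gauss_integrand ha hb
  have hpi : (0 : ℝ) ≤ π / 2 := by positivity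
  have hsq : b ^ 2 ≤ a ^ 2 := by gcongr
  constructor
  · have := intervalIntegral.integral_mono_on (μ := MeasureTheory.volume) (f := fun _ => a⁻¹) hpi
      intervalIntegrable_const (hc.intervalIntegrable 0 (π / 2)) fun θ _ => by
        have h1 := sin_sq_add_cos_sq θ
        refine inv_anti₀ (sqrt_pos.2 (gauss_quadratic_pos ha hb θ)) ?_
        rw [sqrt_le_left ha.le]
        nlinarith [sq_nonneg (sin θ)]
    simpa [gaussIntegral, div_eq_mul_inv] using this
  · have := intervalIntegral.integral_mono_on (μ := MeasureTheory.volume) (g := fun _ => b⁻¹) hpi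
      (hc.intervalIntegrable 0 (π / 2)) intervalIntegrable_const fun θ _ => by
        have h1 := sin_sq_add_cos_sq θ
        refine inv_anti₀ hb ?_
        apply le_sqrt_of_sq_le
        nlinarith [sq_nonneg (cos θ)]
    simpa [gaussIntegral, div_eq_mul_inv] using this

/-- The factor `cos θ` makes the integrand elementary: an antiderivative is `arsinh ((c / b) sin θ)
/ c`. -/
lemma integral_cos_mul_gauss {a b c : ℝ} (ha : 0 < a) (hb : 0 < b) (hc : 0 < c)
    (h : a ^ 2 = b ^ 2 + c ^ 2) :
    ∫ θ in (0 : ℝ)..(π / 2), cos θ * (√(b ^ 2 * cos θ ^ 2 + a ^ 2 * sin θ ^ 2))⁻¹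
      = log ((a + c) / b) / c := by
  have hd : ∀ θ : ℝ, HasDerivAt (fun θ => arsinh (c / b * sin θ) / c)
      (cos θ * (√(b ^ 2 * cos θ ^ 2 + a ^ 2 * sin θ ^ 2))⁻¹) θ := fun θ => by
    have key := ((((hasDerivAt_sin θ).const_mul (c / b)).arsinh).div_const c)
    refine key.congr_deriv ?_
    have h1 := sin_sq_add_cos_sq θ
    have : b ^ 2 * cos θ ^ 2 + a ^ 2 * sin θ ^ 2 = b ^ 2 * (1 + (c / b * sin θ) ^ 2) := by
      field_simp
      rw [h]
      linear_combination b ^ 2 * h1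
    rw [this, sqrt_mul (by positivity), sqrt_sq hb.le]
    have : 0 < √(1 + (c / b * sin θ) ^ 2) := sqrt_pos.2 (by positivity)
    simp only [smul_eq_mul]
    field_simp
  rw [intervalIntegral.integral_eq_sub_of_hasDerivAt (fun θ _ => hd θ)
    ((continuous_cos.mul (continuous_gauss_integrand hb ha)).intervalIntegrable _ _)]
  have h1 : 1 + (c / b) ^ 2 = (a / b) ^ 2 := by field_simp; exact h.symm
  rw [sin_pi_div_two, mul_one, sin_zero, mul_zero, arsinh_zero, zero_div, sub_zero, arsinh, h1,
    sqrt_sq (by positivity), ← add_div, add_comm c]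

/-- Inserting `cos θ` into the integrand changes it by at most `1 / c`, so the elementary integral
captures the logarithmic singularity as `b → 0` up to a bounded error. -/
lemma gaussIntegral_log_bounds {a b c : ℝ} (ha : 0 < a) (hb : 0 < b) (hc : 0 < c)
    (h : a ^ 2 = b ^ 2 + c ^ 2) :
    log ((a + c) / b) / c ≤ gaussIntegral a b ∧
      gaussIntegral a b ≤ (log ((a + c) / b) + π / 2) / c := by
  have hpi : (0 : ℝ) ≤ π / 2 := by positivity
  have hct := continuous_gauss_integrand hb ha
  have hcc : Continuous fun θ => cos θ * (√(b ^ 2 * cos θ ^ 2 + a ^ 2 * sin θ ^ 2))⁻¹ :=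
    continuous_cos.mul hct
  have hrt : ∀ θ : ℝ, 0 < √(b ^ 2 * cos θ ^ 2 + a ^ 2 * sin θ ^ 2) := fun θ =>
    sqrt_pos.2 (gauss_quadratic_pos hb ha θ)
  rw [gaussIntegral_comm, add_div _ (π / 2), ← integral_cos_mul_gauss ha hb hc h, gaussIntegral]
  constructor
  · refine intervalIntegral.integral_mono_on hpi (hcc.intervalIntegrable _ _)
      (hct.intervalIntegrable _ _) fun θ _ => ?_
    exact mul_le_of_le_one_left (inv_pos.2 (hrt θ)).le (cos_le_one θ)
  · have hcst : π / 2 / c = ∫ _ in (0 : ℝ)..(π / 2), c⁻¹ := by simp [div_eq_mul_inv]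
    rw [hcst, ← intervalIntegral.integral_add (hcc.intervalIntegrable _ _)
      intervalIntegrable_const]
    refine intervalIntegral.integral_mono_on hpi (hct.intervalIntegrable _ _)
      ((hcc.add continuous_const).intervalIntegrable _ _) fun θ hθ => ?_
    have hcos : 0 ≤ cos θ := cos_nonneg_of_mem_Icc ⟨by linarith [hθ.1, hpi], hθ.2⟩
    have hsin : 0 ≤ sin θ := sin_nonneg_of_mem_Icc ⟨hθ.1, by linarith [hθ.2]⟩
    have h1 := sin_sq_add_cos_sq θ
    have h2 : c * (1 - cos θ) ≤ √(b ^ 2 * cos θ ^ 2 + a ^ 2 * sin θ ^ 2) := by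
      apply le_sqrt_of_sq_le
      have h3 : (1 - cos θ) ^ 2 ≤ sin θ ^ 2 := by nlinarith [cos_le_one θ]
      have h4 : c ^ 2 * (1 - cos θ) ^ 2 ≤ c ^ 2 * sin θ ^ 2 := by gcongr
      have h5 : 0 ≤ b ^ 2 * cos θ ^ 2 + b ^ 2 * sin θ ^ 2 := by positivity
      rw [h]
      nlinarith
    have hR := hrt θ
    generalize √(b ^ 2 * cos θ ^ 2 + a ^ 2 * sin θ ^ 2) = R at *
    have : (1 - cos θ) * R⁻¹ ≤ c⁻¹ := by
      rw [← div_eq_mul_inv, ← one_div, div_le_div_iff₀ hR hc]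
      linarith
    linarith

/-! ### Monotonicity of `K` and uniqueness of the modulus -/

lemma ellipticK_eq_gaussIntegral {k : ℝ} (hk : k ^ 2 ≤ 1) :
    ellipticK k = gaussIntegral 1 √(1 - k ^ 2) := by
  unfold ellipticK gaussIntegral
  congr 1
  funext θ
  rw [sq_sqrt (by linarith), one_div]
  congr 2
  linear_combination -(sin_sq_add_cos_sq θ)

lemma ellipticK_strictMonoOn : StrictMonoOn ellipticK (Set.Ico 0 1) := by
  intro k hk l hl hkl
  have h1 : k ^ 2 < l ^ 2 := by have := hk.1; gcongr
  have h2 : l ^ 2 < 1 := by nlinarith [hl.1, hl.2]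
  have hpos : ∀ {m : ℝ}, m ^ 2 < 1 → ∀ θ : ℝ, 0 < 1 - m ^ 2 * sin θ ^ 2 := fun {m} hm θ => by
    nlinarith [sin_sq_le_one θ, sq_nonneg m, sq_nonneg (sin θ)]
  have hcont : ∀ {m : ℝ}, m ^ 2 < 1 →
      Continuous fun θ : ℝ => 1 / √(1 - m ^ 2 * sin θ ^ 2) := fun {m} hm =>
    Continuous.div continuous_const (by fun_prop) fun θ => (sqrt_pos.2 (hpos hm θ)).ne'
  refine intervalIntegral.integral_lt_integral_of_continuousOn_of_le_of_exists_lt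
    (by positivity) (hcont (h1.trans h2)).continuousOn (hcont h2).continuousOn
    (fun θ _ => ?_) ⟨π / 2, ⟨by positivity, le_rfl⟩, ?_⟩
  · refine one_div_le_one_div_of_le (sqrt_pos.2 (hpos h2 θ)) (sqrt_le_sqrt ?_)
    nlinarith [sq_nonneg (sin θ)]
  · refine one_div_lt_one_div_of_lt (sqrt_pos.2 (hpos h2 _)) (sqrt_lt_sqrt (hpos h2 _).le ?_)
    rw [sin_pi_div_two]
    linarith

lemma ellipticK_pos {k : ℝ} (hk : k ∈ Set.Ico (0 : ℝ) 1) : 0 < ellipticK k := by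
  have h0 : ellipticK 0 = π / 2 := by simp [ellipticK]
  have := ellipticK_strictMonoOn.monotoneOn ⟨le_rfl, one_pos⟩ hk hk.1
  have := pi_pos
  linarith

/-- There is at most one modulus belonging to a given `r`. -/
theorem IsModulusOf.unique {r k l : ℝ} (hk : IsModulusOf r k) (hl : IsModulusOf r l) : k = l := by
  wlog hkl : k ≤ l generalizing k l
  · exact (this hl hk (le_of_not_ge hkl)).symm
  refine hkl.antisymm (not_lt.1 fun hlt => ?_)
  obtain ⟨hk0, hk1, hk⟩ := hk
  obtain ⟨hl0, hl1, hl⟩ := hl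
  have hmem : ∀ {m : ℝ}, 0 < m → m < 1 → √(1 - m ^ 2) ∈ Set.Ico (0 : ℝ) 1 := fun {m} h0 h1 =>
    ⟨sqrt_nonneg _, by rw [sqrt_lt' one_pos]; nlinarith⟩
  have h1 := ellipticK_strictMonoOn ⟨hk0.le, hk1⟩ ⟨hl0.le, hl1⟩ hlt
  have h2 := ellipticK_strictMonoOn (hmem hl0 hl1) (hmem hk0 hk1)
    (sqrt_lt_sqrt (by nlinarith) (by nlinarith))
  have h3 := ellipticK_pos ⟨hk0.le, hk1⟩
  have h4 := ellipticK_pos (hmem hl0 hl1)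
  have h5 : ellipticK √(1 - l ^ 2) / ellipticK l < ellipticK √(1 - k ^ 2) / ellipticK k :=
    div_lt_div₀ h2 h1.le (h4.trans h2).le h3
  linarith

/-! ### Lattice sums of the hyperbolic secant -/

lemma inv_cosh_le_two_mul_exp_neg (x : ℝ) : (cosh x)⁻¹ ≤ 2 * exp (-x) := by
  have h : exp x / 2 ≤ cosh x := by rw [cosh_eq]; linarith [exp_pos (-x)]
  calc (cosh x)⁻¹ ≤ (exp x / 2)⁻¹ := inv_anti₀ (by positivity) h
    _ = 2 * exp (-x) := by rw [exp_neg, inv_div, div_eq_mul_inv]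

lemma exp_neg_le_inv_cosh {x : ℝ} (hx : 0 ≤ x) : exp (-x) ≤ (cosh x)⁻¹ := by
  rw [exp_neg]
  refine inv_anti₀ (cosh_pos x) ?_
  rw [cosh_eq]
  linarith [exp_le_exp.2 (show -x ≤ x by linarith)]

lemma summable_inv_cosh (x : ℝ) {s : ℝ} (hs : 0 < s) :
    Summable fun n : ℤ => (cosh ((n + x) * s))⁻¹ := by
  have hgeo : Summable fun n : ℕ => exp (-s) ^ n :=
    summable_geometric_of_lt_one (exp_pos _).le (by rw [exp_lt_one_iff]; linarith)
  have key : ∀ y : ℝ, Summable fun n : ℕ => (cosh ((n + y) * s))⁻¹ := fun y => by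
    refine Summable.of_nonneg_of_le (fun n => (inv_pos.2 (cosh_pos _)).le)
      (fun n => inv_cosh_le_two_mul_exp_neg _) ((hgeo.mul_left (2 * exp (-(y * s)))).congr fun n => ?_)
    rw [← exp_nat_mul, mul_assoc, ← exp_add]
    ring_nf
  refine Summable.of_nat_of_neg_add_one (by simpa using key x) ((key (1 - x)).congr fun n => ?_)
  rw [← cosh_neg]
  push_cast
  ring_nf

/-- A lattice sum of hyperbolic secants. -/
noncomputable def sechSum (x s : ℝ) : ℝ := ∑' n : ℤ, (cosh ((n + x) * s))⁻¹

/-- The alternating lattice sum of hyperbolic secants. -/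
noncomputable def altSechSum (s : ℝ) : ℝ := ∑' n : ℤ, (-1 : ℝ) ^ n * (cosh (n * s))⁻¹

lemma norm_neg_one_zpow_mul (n : ℤ) (y : ℝ) : ‖(-1 : ℝ) ^ n * y‖ = ‖y‖ := by
  rw [norm_mul, norm_zpow, norm_neg, norm_one, one_zpow, one_mul]

lemma summable_alt_inv_cosh {s : ℝ} (hs : 0 < s) :
    Summable fun n : ℤ => (-1 : ℝ) ^ n * (cosh (n * s))⁻¹ := by
  refine Summable.of_norm ?_
  simp only [norm_neg_one_zpow_mul]
  simpa using (summable_inv_cosh 0 hs).norm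

/-! ### Telescoping over the integers -/

lemma hasSum_int_telescope_one {F : ℤ → ℝ} {a b : ℝ} (hF : Monotone F)
    (ha : Tendsto F atTop (𝓝 a)) (hb : Tendsto F atBot (𝓝 b)) :
    HasSum (fun n : ℤ => F (n + 1) - F n) (a - b) := by
  have h1 : HasSum (fun n : ℕ => F ((n : ℤ) + 1) - F n) (a - F 0) := by
    rw [hasSum_iff_tendsto_nat_of_nonneg fun n => sub_nonneg.2 (hF (by lia))]
    have : ∀ N : ℕ, ∑ n ∈ Finset.range N, (F ((n : ℤ) + 1) - F n) = F N - F 0 := fun N => by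
      simpa using Finset.sum_range_sub (fun n : ℕ => F n) N
    simp only [this]
    exact (ha.comp tendsto_natCast_atTop_atTop).sub_const _
  have h2 : HasSum (fun n : ℕ => F (-((n : ℤ) + 1) + 1) - F (-((n : ℤ) + 1))) (F 0 - b) := by
    rw [hasSum_iff_tendsto_nat_of_nonneg fun n => sub_nonneg.2 (hF (by lia))]
    have : ∀ N : ℕ, ∑ n ∈ Finset.range N, (F (-((n : ℤ) + 1) + 1) - F (-((n : ℤ) + 1)))
        = F 0 - F (-(N : ℤ)) := fun N => by
      simpa using Finset.sum_range_sub' (fun n : ℕ => F (-(n : ℤ))) N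
    simp only [this]
    exact (hb.comp (tendsto_neg_atTop_atBot.comp tendsto_natCast_atTop_atTop)).const_sub _
  have := h1.of_nat_of_neg_add_one (f := fun n : ℤ => F (n + 1) - F n) h2
  rwa [sub_add_sub_cancel] at this

lemma hasSum_int_telescope {F : ℤ → ℝ} {a b : ℝ} (hF : Monotone F)
    (ha : Tendsto F atTop (𝓝 a)) (hb : Tendsto F atBot (𝓝 b)) (m : ℤ) :
    HasSum (fun n : ℤ => F (n + m) - F n) (m * (a - b)) := by
  have h1 : ∀ m : ℤ, HasSum (fun n : ℤ => F (n + m + 1) - F (n + m)) (a - b) := fun m => by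
    have h := (Equiv.addRight m).hasSum_iff (f := fun n : ℤ => F (n + 1) - F n) (a := a - b)
    simp only [Function.comp_def, Equiv.coe_addRight] at h
    exact h.2 (hasSum_int_telescope_one hF ha hb)
  induction m using Int.induction_on with
  | zero => simp
  | succ i ih =>
    convert ih.add (h1 i) using 1
    · funext n
      rw [add_assoc]
      ring
    · push_cast
      ring
  | pred i ih =>
    rw [show ((-(i : ℤ) - 1 : ℤ) : ℝ) * (a - b) = ((-(i : ℤ) : ℤ) : ℝ) * (a - b) - (a - b) by
      push_cast; ring]
    have h := ih.sub (h1 (-i - 1))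
    refine h.congr_fun fun n => ?_
    rw [show n + (-(i : ℤ) - 1) + 1 = n + -i by ring]
    ring

lemma tanh_eq_one_sub (x : ℝ) : tanh x = 1 - 2 / (exp (2 * x) + 1) := by
  rw [tanh_eq_sinh_div_cosh, sinh_eq, cosh_eq, two_mul, exp_add, exp_neg]
  have := exp_pos x
  field_simp
  ring

lemma monotone_tanh : Monotone tanh := fun x y h => by
  rw [tanh_eq_one_sub, tanh_eq_one_sub]
  gcongr

lemma tendsto_tanh_atTop : Tendsto tanh atTop (𝓝 1) := by
  have h : Tendsto (fun x : ℝ => exp (2 * x) + 1) atTop atTop :=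
    tendsto_atTop_add_const_right _ _
      (tendsto_exp_atTop.comp (tendsto_id.const_mul_atTop two_pos))
  have := (h.const_div_atTop 2).const_sub 1
  simpa only [← tanh_eq_one_sub, sub_zero] using this

lemma tendsto_tanh_atBot : Tendsto tanh atBot (𝓝 (-1)) := by
  have := (tendsto_tanh_atTop.comp tendsto_neg_atBot_atTop).neg
  refine this.congr fun x => ?_
  simp

lemma hasSum_tanh_sub (x : ℝ) {s : ℝ} (hs : 0 < s) (m : ℤ) :
    HasSum (fun n : ℤ => tanh ((n + x) * s) - tanh ((n - m + x) * s)) (2 * m) := by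
  have hmono : Monotone fun n : ℤ => tanh ((n + x) * s) := fun n k h => monotone_tanh (by gcongr)
  have hT : Tendsto (fun n : ℤ => ((n : ℝ) + x) * s) atTop atTop :=
    (tendsto_atTop_add_const_right _ _ tendsto_intCast_atTop_atTop).atTop_mul_const hs
  have hB : Tendsto (fun n : ℤ => ((n : ℝ) + x) * s) atBot atBot :=
    (tendsto_atBot_add_const_right _ _ (tendsto_intCast_atBot_iff.2 tendsto_id)).atBot_mul_const hs
  have h := (hasSum_int_telescope hmono (tendsto_tanh_atTop.comp hT) (tendsto_tanh_atBot.comp hB)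
    (-m)).neg
  rw [show -(((-m : ℤ) : ℝ) * (1 - -1)) = 2 * m by push_cast; ring] at h
  refine HasSum.congr_fun h fun n => ?_
  push_cast
  ring_nf

/-- With `u + v = m s`, `sech u · sech v = (tanh u + tanh v) / sinh (m s)`, and the numerator
telescopes with step `m`. The value does not depend on the shift `x`, which is what lets `L²` and
`N²` be compared. -/
lemma hasSum_inv_cosh_convolution (x : ℝ) {s : ℝ} (hs : 0 < s) {m : ℤ} (hm : m ≠ 0) :
    HasSum (fun n : ℤ => (cosh ((n + x) * s))⁻¹ * (cosh (((m - n : ℤ) - x) * s))⁻¹)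
      (2 * m / sinh (m * s)) := by
  have hms : sinh (m * s) ≠ 0 := by
    rw [Ne, sinh_eq_zero]
    exact mul_ne_zero (Int.cast_ne_zero.2 hm) hs.ne'
  refine HasSum.congr_fun ((hasSum_tanh_sub x hs m).div_const (sinh (m * s))) fun n => ?_
  have h1 := (cosh_pos ((n + x) * s)).ne'
  have h2 := (cosh_pos (((m - n : ℤ) - x) * s)).ne'
  rw [show ((n : ℝ) - m + x) * s = -(((m - n : ℤ) - x) * s) by push_cast; ring, tanh_neg,
    tanh_eq_sinh_div_cosh, tanh_eq_sinh_div_cosh]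
  rw [show (m : ℝ) * s = (n + x) * s + ((m - n : ℤ) - x) * s by push_cast; ring, sinh_add] at hms ⊢
  generalize ((n : ℝ) + x) * s = u at *
  generalize (((m - n : ℤ) : ℝ) - x) * s = v at *
  rw [sub_neg_eq_add, div_add_div _ _ h1 h2, div_div, ← mul_inv, inv_eq_one_div,
    div_eq_div_iff (mul_ne_zero h1 h2) (mul_ne_zero (mul_ne_zero h1 h2) hms)]
  ring

/-! ### Squares of the lattice sums -/

lemma hasSum_int_convolution {f g : ℤ → ℝ} (hf : Summable f) (hg : Summable g) :
    HasSum (fun m : ℤ => ∑' n : ℤ, f n * g (m - n)) ((∑' n, f n) * ∑' n, g n) := by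
  let e : ℤ × ℤ ≃ ℤ × ℤ :=
    { toFun := fun p => (p.2, p.1 - p.2)
      invFun := fun p => (p.1 + p.2, p.1)
      left_inv := fun p => by simp
      right_inv := fun p => by simp }
  have h1 : Summable fun p : ℤ × ℤ => f p.1 * g p.2 :=
    summable_mul_of_summable_norm hf.norm hg.norm
  have h2 : Summable fun p : ℤ × ℤ => f p.2 * g (p.1 - p.2) :=
    (e.summable_iff (f := fun p : ℤ × ℤ => f p.1 * g p.2)).2 h1
  have h3 : ∑' p : ℤ × ℤ, f p.2 * g (p.1 - p.2) = (∑' n, f n) * ∑' n, g n := by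
    rw [hf.tsum_mul_tsum hg h1]
    exact e.tsum_eq fun p : ℤ × ℤ => f p.1 * g p.2
  rw [← h3, h2.tsum_prod]
  exact h2.prod.hasSum

lemma tsum_inv_cosh_sub (x s : ℝ) :
    ∑' n : ℤ, (cosh ((n - x) * s))⁻¹ = sechSum x s := by
  rw [sechSum, ← (Equiv.neg ℤ).tsum_eq]
  refine tsum_congr fun n => ?_
  rw [← cosh_neg]
  simp only [Equiv.neg_apply]
  push_cast
  ring_nf

lemma hasSum_sechSum_sq (x : ℝ) {s : ℝ} (hs : 0 < s) :
    HasSum (fun m : ℤ => 2 * m / sinh (m * s))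
      (sechSum x s ^ 2 - ∑' n : ℤ, (cosh ((n + x) * s))⁻¹ ^ 2) := by
  have hg : Summable fun n : ℤ => (cosh ((n - x) * s))⁻¹ := by
    simpa [sub_eq_add_neg] using summable_inv_cosh (-x) hs
  have h := hasSum_int_convolution (summable_inv_cosh x hs) hg
  rw [tsum_inv_cosh_sub, ← sechSum, ← sq] at h
  have h0 := hasSum_ite_eq (0 : ℤ) (∑' n : ℤ, (cosh ((n + x) * s))⁻¹ ^ 2)
  have h' := h.sub h0
  refine h'.congr_fun fun m => ?_
  -- The `m = 0` convolution is the sum of squares; it is subtracted off, matching the value `0 /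
  -- sinh 0 = 0`.
  rcases eq_or_ne m 0 with rfl | hm
  · simp only [Int.cast_zero, mul_zero, zero_mul, zero_div, if_true]
    rw [eq_comm, sub_eq_zero]
    refine tsum_congr fun n => ?_
    rw [sq, ← cosh_neg ((((0 - n : ℤ) : ℝ) - x) * s)]
    push_cast
    ring_nf
  · rw [if_neg hm, sub_zero, (hasSum_inv_cosh_convolution x hs hm).tsum_eq]

lemma hasSum_altSechSum_sq {s : ℝ} (hs : 0 < s) :
    HasSum (fun m : ℤ => (-1 : ℝ) ^ m * (2 * m / sinh (m * s)))
      (altSechSum s ^ 2 - ∑' n : ℤ, (cosh ((n + 0) * s))⁻¹ ^ 2) := by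
  have h := hasSum_int_convolution (summable_alt_inv_cosh hs) (summable_alt_inv_cosh hs)
  rw [← altSechSum, ← sq] at h
  have h0 := hasSum_ite_eq (0 : ℤ) (∑' n : ℤ, (cosh (((n : ℝ) + 0) * s))⁻¹ ^ 2)
  have hsign : ∀ m n : ℤ, (-1 : ℝ) ^ n * (cosh (n * s))⁻¹ * ((-1 : ℝ) ^ (m - n)
      * (cosh ((m - n : ℤ) * s))⁻¹)
      = (-1 : ℝ) ^ m * ((cosh ((n + 0) * s))⁻¹ * (cosh (((m - n : ℤ) - 0) * s))⁻¹) := fun m n => by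
    rw [add_zero, sub_zero, show (-1 : ℝ) ^ m = (-1) ^ n * (-1) ^ (m - n) by
      rw [← zpow_add₀ (by norm_num), add_sub_cancel]]
    ring
  simp only [hsign, tsum_mul_left] at h
  have h' := h.sub h0
  refine h'.congr_fun fun m => ?_
  rcases eq_or_ne m 0 with rfl | hm
  · simp only [Int.cast_zero, mul_zero, zero_mul, zero_div, if_true, zpow_zero, one_mul]
    rw [eq_comm, sub_eq_zero]
    refine tsum_congr fun n => ?_
    rw [sq, ← cosh_neg ((((0 - n : ℤ) : ℝ) - 0) * s)]
    push_cast
    ring_nf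
  · rw [if_neg hm, sub_zero, (hasSum_inv_cosh_convolution 0 hs hm).tsum_eq]

/-! ### Double series -/

/-- Fubini for an absolutely convergent double series, in the form that transfers a known total from
row sums to column sums. -/
lemma HasSum.swap_nat {f : ℕ → ℕ → ℝ} {r c : ℕ → ℝ} {a : ℝ}
    (hf : Summable fun p : ℕ × ℕ => f p.1 p.2) (hr : ∀ i, HasSum (f i) (r i))
    (hc : ∀ j, HasSum (fun i => f i j) (c j)) (ha : HasSum r a) : HasSum c a := by
  have h1 : HasSum r (∑' p : ℕ × ℕ, f p.1 p.2) := hf.hasSum.prod_fiberwise hr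
  have h2 : HasSum (fun p : ℕ × ℕ => f p.2 p.1) (∑' p : ℕ × ℕ, f p.1 p.2) :=
    (Equiv.prodComm ℕ ℕ).hasSum_iff (f := fun p : ℕ × ℕ => f p.1 p.2) |>.2 hf.hasSum
  rw [ha.unique h1]
  exact h2.prod_fiberwise hc

lemma one_div_two_mul (x : ℝ) : 1 / (2 * x) = x⁻¹ / 2 := by
  rw [one_div, mul_inv]
  ring

lemma hasSum_exp_neg_odd_mul {y : ℝ} (hy : 0 < y) :
    HasSum (fun n : ℕ => exp (-((2 * n + 1) * y))) (1 / (2 * sinh y)) := by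
  have h1 : exp (-(2 * y)) < 1 := by rw [exp_lt_one_iff]; linarith
  have h := (hasSum_geometric_of_lt_one (exp_pos _).le h1).mul_left (exp (-y))
  have he : exp (-y) * (1 - exp (-(2 * y)))⁻¹ = 1 / (2 * sinh y) := by
    rw [sinh_eq, show -(2 * y) = -y + -y by ring, exp_add, exp_neg]
    rw [show -(2 * y) = -y + -y by ring, exp_add, exp_neg] at h1
    have := exp_pos y
    have h3 : exp y - (exp y)⁻¹ ≠ 0 := by
      rw [← exp_neg, sub_ne_zero]
      exact (exp_lt_exp.2 (by linarith)).ne'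
    have h4 : 1 - (exp y)⁻¹ * (exp y)⁻¹ ≠ 0 := by linarith
    have h5 : exp y - (exp y)⁻¹ = exp y * (1 - (exp y)⁻¹ * (exp y)⁻¹) := by field_simp
    rw [h5]
    field_simp
  rw [he] at h
  refine h.congr_fun fun n => ?_
  rw [← exp_nat_mul, ← exp_add]
  ring_nf

lemma hasSum_alt_exp_neg_odd_mul {y : ℝ} (hy : 0 < y) :
    HasSum (fun n : ℕ => (-1 : ℝ) ^ n * exp (-((2 * n + 1) * y))) (1 / (2 * cosh y)) := by
  have h1 : ‖-exp (-(2 * y))‖ < 1 := by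
    rw [norm_neg, norm_of_nonneg (exp_pos _).le, exp_lt_one_iff]; linarith
  have h := (hasSum_geometric_of_norm_lt_one h1).mul_left (exp (-y))
  have he : exp (-y) * (1 - -exp (-(2 * y)))⁻¹ = 1 / (2 * cosh y) := by
    rw [cosh_eq, show -(2 * y) = -y + -y by ring, exp_add, exp_neg, sub_neg_eq_add]
    have := exp_pos y
    field_simp
  rw [he] at h
  refine h.congr_fun fun n => ?_
  rw [neg_pow (exp _), ← exp_nat_mul, mul_left_comm, ← exp_add]
  ring_nf

lemma hasSum_alt_mul_exp_neg_mul {y : ℝ} (hy : 0 < y) :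
    HasSum (fun n : ℕ => (-1 : ℝ) ^ n * (n * exp (-(n * (2 * y))))) (-((cosh y)⁻¹ ^ 2 / 4)) := by
  have h1 : ‖-exp (-(2 * y))‖ < 1 := by
    rw [norm_neg, norm_of_nonneg (exp_pos _).le, exp_lt_one_iff]; linarith
  have h := hasSum_coe_mul_geometric_of_norm_lt_one h1
  have he : -exp (-(2 * y)) / (1 - -exp (-(2 * y))) ^ 2 = -((cosh y)⁻¹ ^ 2 / 4) := by
    rw [cosh_eq, show -(2 * y) = -y + -y by ring, exp_add, exp_neg, sub_neg_eq_add]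
    have := exp_pos y
    field_simp
    norm_num
  rw [he] at h
  refine h.congr_fun fun n => ?_
  rw [neg_pow (exp _), ← exp_nat_mul]
  ring_nf

lemma summable_exp_neg_nat_mul {s : ℝ} (hs : 0 < s) : Summable fun n : ℕ => exp (-(n * s)) := by
  refine (summable_geometric_of_lt_one (exp_pos (-s)).le
    (by rw [exp_lt_one_iff]; linarith)).congr fun n => ?_
  rw [← exp_nat_mul]
  ring_nf

lemma norm_neg_one_pow_mul (n : ℕ) (y : ℝ) : ‖(-1 : ℝ) ^ n * y‖ = ‖y‖ := by
  rw [norm_mul, norm_pow, norm_neg, norm_one, one_pow, one_mul]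

lemma summable_alt_exp_neg_odd_mul_odd {s : ℝ} (hs : 0 < s) :
    Summable fun p : ℕ × ℕ => (-1 : ℝ) ^ p.2 * exp (-((2 * p.2 + 1) * ((2 * p.1 + 1) * s))) := by
  refine Summable.of_norm_bounded (g := fun p : ℕ × ℕ => exp (-(p.1 * s)) * exp (-(p.2 * s)))
    (Summable.mul_of_nonneg (f := fun n : ℕ => exp (-(n * s))) (g := fun n : ℕ => exp (-(n * s)))
      (summable_exp_neg_nat_mul hs) (summable_exp_neg_nat_mul hs)
      (fun _ => (exp_pos _).le) fun _ => (exp_pos _).le) fun p => ?_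
  rw [norm_neg_one_pow_mul, norm_of_nonneg (exp_pos _).le, ← exp_add, exp_le_exp]
  have h1 : (0 : ℝ) ≤ p.1 * s := by positivity
  have h2 : (0 : ℝ) ≤ p.2 * s := by positivity
  have h3 : (0 : ℝ) ≤ p.2 * (p.1 * s) := by positivity
  nlinarith

lemma cosh_neg_add_one_add_half (n : ℕ) (s : ℝ) :
    cosh (((-((n : ℤ) + 1) : ℤ) + 1 / 2) * s) = cosh ((n + 1 / 2) * s) := by
  rw [← cosh_neg]
  push_cast
  ring_nf

lemma hasSum_two_mul_inv_cosh_half {s : ℝ} (hs : 0 < s) :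
    HasSum (fun n : ℕ => 2 * (cosh ((n + 1 / 2) * s))⁻¹) (sechSum (1 / 2) s) := by
  have h := (summable_inv_cosh (1 / 2) hs).hasSum.nat_add_neg_add_one
  refine h.congr_fun fun n => ?_
  rw [cosh_neg_add_one_add_half, two_mul, Int.cast_natCast]

/-- The half-integer lattice sum of `sech` as an alternating sum of reciprocals of `sinh`. -/
lemma hasSum_alt_div_sinh {s : ℝ} (hs : 0 < s) :
    HasSum (fun n : ℕ => (-1 : ℝ) ^ n / sinh ((n + 1 / 2) * s)) (sechSum (1 / 2) s / 2) := by
  have hrow : ∀ n : ℕ, HasSum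
      (fun j : ℕ => (-1 : ℝ) ^ j * exp (-((2 * j + 1) * ((2 * n + 1) * (s / 2)))))
      (2 * (cosh ((n + 1 / 2) * s))⁻¹ / 4) := fun n => by
    rw [show 2 * (cosh ((n + 1 / 2) * s))⁻¹ / 4 = 1 / (2 * cosh ((2 * n + 1) * (s / 2))) by
      rw [one_div_two_mul, show (2 * (n : ℝ) + 1) * (s / 2) = (n + 1 / 2) * s by ring]; ring]
    exact hasSum_alt_exp_neg_odd_mul (by positivity)
  have hcol : ∀ j : ℕ, HasSum
      (fun n : ℕ => (-1 : ℝ) ^ j * exp (-((2 * j + 1) * ((2 * n + 1) * (s / 2)))))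
      ((-1 : ℝ) ^ j / sinh ((j + 1 / 2) * s) / 2) := fun j => by
    rw [show (-1 : ℝ) ^ j / sinh ((j + 1 / 2) * s) / 2
      = (-1 : ℝ) ^ j * (1 / (2 * sinh ((j + 1 / 2) * s))) by rw [one_div_two_mul]; ring]
    refine ((hasSum_exp_neg_odd_mul (by positivity)).mul_left _).congr_fun fun n => ?_
    ring_nf
  have h := (HasSum.swap_nat
    (f := fun n j => (-1 : ℝ) ^ j * exp (-((2 * j + 1) * ((2 * n + 1) * (s / 2)))))
    (summable_alt_exp_neg_odd_mul_odd (half_pos hs)) hrow hcol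
    ((hasSum_two_mul_inv_cosh_half hs).div_const 4)).mul_right 2
  rw [show sechSum (1 / 2) s / 2 = sechSum (1 / 2) s / 4 * 2 by ring]
  refine h.congr_fun fun n => ?_
  ring

lemma summable_alt_mul_exp_neg_mul_odd {s : ℝ} (hs : 0 < s) :
    Summable fun p : ℕ × ℕ => (-1 : ℝ) ^ p.2 * (p.2 * exp (-(p.2 * ((2 * p.1 + 1) * s)))) := by
  have h1 : Summable fun j : ℕ => (j : ℝ) * exp (-(j * s)) := by
    have h := summable_pow_mul_geometric_of_norm_lt_one 1 (r := exp (-s))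
      (by rw [norm_of_nonneg (exp_pos _).le, exp_lt_one_iff]; linarith)
    refine h.congr fun j => ?_
    rw [← exp_nat_mul, pow_one]
    ring_nf
  refine Summable.of_norm_bounded
    (g := fun p : ℕ × ℕ => exp (-(p.1 * s)) * (p.2 * exp (-(p.2 * s))))
    (Summable.mul_of_nonneg (f := fun n : ℕ => exp (-(n * s)))
      (g := fun n : ℕ => (n : ℝ) * exp (-(n * s))) (summable_exp_neg_nat_mul hs) h1
      (fun _ => (exp_pos _).le) fun _ => by positivity) fun ⟨i, j⟩ => ?_
  rw [norm_neg_one_pow_mul, norm_of_nonneg (by positivity), mul_left_comm (exp _), ← exp_add]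
  dsimp only
  rcases Nat.eq_zero_or_pos j with rfl | hj
  · simp
  refine mul_le_mul_of_nonneg_left (exp_le_exp.2 ?_) j.cast_nonneg
  have h2 : (1 : ℝ) ≤ j := by exact_mod_cast hj
  have h3 : (0 : ℝ) ≤ i * s := by positivity
  nlinarith

lemma hasSum_two_mul_inv_cosh_half_sq {s : ℝ} (hs : 0 < s) :
    HasSum (fun n : ℕ => 2 * (cosh ((n + 1 / 2) * s))⁻¹ ^ 2)
      (∑' n : ℤ, (cosh ((n + 1 / 2) * s))⁻¹ ^ 2) := by
  have hsum : Summable fun n : ℤ => (cosh ((n + 1 / 2) * s))⁻¹ ^ 2 :=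
    (summable_inv_cosh (1 / 2) hs).of_nonneg_of_le (fun n => sq_nonneg _) fun n =>
      pow_le_of_le_one (inv_pos.2 (cosh_pos _)).le (inv_le_one_of_one_le₀ (one_le_cosh _)) two_ne_zero
  refine hsum.hasSum.nat_add_neg_add_one.congr_fun fun n => ?_
  rw [cosh_neg_add_one_add_half, two_mul, Int.cast_natCast]

/-- Both sides come from the double series of `(-1)^j j e^{-j(2n+1)s}`: summing over `j` first gives
`-sech² / 4` at half-integers, summing over `n` first gives the `m / sinh (m s)` terms of
`hasSum_altSechSum_sq`. -/
lemma altSechSum_sq_sub_tsum {s : ℝ} (hs : 0 < s) :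
    altSechSum s ^ 2 - ∑' n : ℤ, (cosh ((n + 0) * s))⁻¹ ^ 2
      = -∑' n : ℤ, (cosh ((n + 1 / 2) * s))⁻¹ ^ 2 := by
  have hrow : ∀ n : ℕ, HasSum
      (fun j : ℕ => (-1 : ℝ) ^ j * (j * exp (-(j * ((2 * n + 1) * s)))))
      (2 * (cosh ((n + 1 / 2) * s))⁻¹ ^ 2 / -8) := fun n => by
    have h := hasSum_alt_mul_exp_neg_mul (y := (n + 1 / 2) * s) (by positivity)
    rw [show 2 * ((n + 1 / 2) * s) = (2 * n + 1) * s by ring] at h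
    rwa [show 2 * (cosh ((n + 1 / 2) * s))⁻¹ ^ 2 / -8 = -((cosh ((n + 1 / 2) * s))⁻¹ ^ 2 / 4) by ring]
  have hcol : ∀ j : ℕ, HasSum
      (fun n : ℕ => (-1 : ℝ) ^ j * (j * exp (-(j * ((2 * n + 1) * s)))))
      ((-1 : ℝ) ^ j * (j * (1 / (2 * sinh (j * s))))) := fun j => by
    rcases Nat.eq_zero_or_pos j with rfl | hj
    · simp
    refine (((hasSum_exp_neg_odd_mul (by positivity)).mul_left _).mul_left _).congr_fun fun n => ?_
    ring_nf
  have h1 := (HasSum.swap_nat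
    (f := fun n j => (-1 : ℝ) ^ j * (j * exp (-(j * ((2 * n + 1) * s)))))
    (summable_alt_mul_exp_neg_mul_odd hs) hrow hcol
    ((hasSum_two_mul_inv_cosh_half_sq hs).div_const (-8))).mul_right 8
  have h2 := (hasSum_altSechSum_sq hs).nat_add_neg
  have h3 := h2.unique (h1.congr_fun fun n => by
    rw [zpow_neg, ← inv_zpow, inv_neg_one, zpow_natCast]
    push_cast
    rw [neg_mul, sinh_neg, one_div_two_mul]
    ring)
  -- Folding the integers at `0` counts the central term twice; that term vanishes.
  simp only [Int.cast_zero, mul_zero, zero_div, add_zero] at h3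
  simp only [add_zero]
  linarith

/-- The quadratic relation between the three lattice sums, the analogue of Jacobi's
quartic identity. -/
theorem sechSum_zero_sq {s : ℝ} (hs : 0 < s) :
    sechSum 0 s ^ 2 = altSechSum s ^ 2 + sechSum (1 / 2) s ^ 2 := by
  have h1 := (hasSum_sechSum_sq 0 hs).unique (hasSum_sechSum_sq (1 / 2) hs)
  have h2 := altSechSum_sq_sub_tsum hs
  linarith

/-! ### Duplication formulas -/

lemma sechSum_zero_add_altSechSum {s : ℝ} (hs : 0 < s) :
    sechSum 0 s + altSechSum s = 2 * sechSum 0 (2 * s) := by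
  have h0 : Summable fun n : ℤ => (cosh (n * s))⁻¹ := by simpa using summable_inv_cosh 0 hs
  unfold sechSum altSechSum
  simp only [add_zero]
  rw [← h0.tsum_add (summable_alt_inv_cosh hs), ← tsum_mul_left,
    ← (mul_right_injective₀ (two_ne_zero (α := ℤ))).tsum_eq]
  · refine tsum_congr fun n => ?_
    rw [zpow_mul]
    push_cast
    norm_num
    ring_nf
  · intro n hn
    by_contra hodd
    have : Odd n := by
      rw [← Int.not_even_iff_odd, even_iff_two_dvd]
      rintro ⟨k, rfl⟩
      exact hodd ⟨k, rfl⟩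
    apply hn
    simp only [this.neg_one_zpow]
    ring

lemma sechSum_zero_sub_altSechSum {s : ℝ} (hs : 0 < s) :
    sechSum 0 s - altSechSum s = 2 * sechSum (1 / 2) (2 * s) := by
  have h0 : Summable fun n : ℤ => (cosh (n * s))⁻¹ := by simpa using summable_inv_cosh 0 hs
  have hinj : Function.Injective fun n : ℤ => 2 * n + 1 := fun a b h => by simpa using h
  unfold sechSum altSechSum
  simp only [add_zero]
  rw [← h0.tsum_sub (summable_alt_inv_cosh hs), ← tsum_mul_left, ← hinj.tsum_eq]
  · refine tsum_congr fun n => ?_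
    rw [(odd_two_mul_add_one n).neg_one_zpow,
      show (((2 * n + 1 : ℤ) : ℝ)) * s = (n + 1 / 2) * (2 * s) by push_cast; ring]
    ring
  · intro n hn
    by_contra hodd
    have : Even n := by
      rw [← Int.not_odd_iff_even]
      rintro ⟨k, rfl⟩
      exact hodd ⟨k, rfl⟩
    apply hn
    simp only [this.neg_one_zpow]
    ring

lemma sechSum_zero_mul_altSechSum {s : ℝ} (hs : 0 < s) :
    sechSum 0 s * altSechSum s = altSechSum (2 * s) ^ 2 := by
  have h1 := sechSum_zero_sq (s := 2 * s) (by positivity)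
  have h2 := sechSum_zero_add_altSechSum hs
  have h3 := sechSum_zero_sub_altSechSum hs
  have h4 : sechSum 0 (2 * s) = (sechSum 0 s + altSechSum s) / 2 := by linarith
  have h5 : sechSum (1 / 2) (2 * s) = (sechSum 0 s - altSechSum s) / 2 := by linarith
  rw [h4, h5] at h1
  linear_combination h1

/-! ### Limits and positivity -/

lemma one_le_sechSum_zero {s : ℝ} (hs : 0 < s) : 1 ≤ sechSum 0 s := by
  have h := (summable_inv_cosh 0 hs).le_tsum 0 fun n _ => (inv_pos.2 (cosh_pos _)).le
  simpa [sechSum] using h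

lemma sechSum_half_bounds {s : ℝ} (hs : 0 < s) :
    2 * exp (-(s / 2)) ≤ sechSum (1 / 2) s ∧
      sechSum (1 / 2) s ≤ 4 * exp (-(s / 2)) * (1 - exp (-s))⁻¹ := by
  have h := hasSum_two_mul_inv_cosh_half hs
  constructor
  · have h0 := le_hasSum h 0 fun n _ => by have := inv_pos.2 (cosh_pos ((n + 1 / 2) * s)); positivity
    have h1 := exp_neg_le_inv_cosh (half_pos hs).le
    rw [Nat.cast_zero, zero_add, one_div_mul_eq_div] at h0
    linarith
  · have hg := (hasSum_geometric_of_lt_one (exp_pos (-s)).le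
      (by rw [exp_lt_one_iff]; linarith)).mul_left (4 * exp (-(s / 2)))
    refine hasSum_le (fun n => ?_) h hg
    have h1 := inv_cosh_le_two_mul_exp_neg ((n + 1 / 2) * s)
    rw [← exp_nat_mul, mul_assoc 4, ← exp_add]
    rw [show -((n + 1 / 2) * s) = -(s / 2) + n * -s by ring] at h1
    linarith

lemma tendsto_two_pow_mul_atTop {s : ℝ} (hs : 0 < s) :
    Tendsto (fun n : ℕ => 2 ^ n * s) atTop atTop :=
  (tendsto_pow_atTop_atTop_of_one_lt one_lt_two).atTop_mul_const hs

lemma tendsto_inv_cosh_atTop : Tendsto (fun x : ℝ => (cosh x)⁻¹) atTop (𝓝 0) := by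
  refine squeeze_zero (fun x => (inv_pos.2 (cosh_pos x)).le) inv_cosh_le_two_mul_exp_neg ?_
  simpa using (tendsto_exp_neg_atTop_nhds_zero.const_mul 2)

lemma tendsto_inv_cosh_int_mul {s : ℝ} (hs : 0 < s) (m : ℤ) :
    Tendsto (fun k : ℕ => (cosh (m * (2 ^ k * s)))⁻¹) atTop (𝓝 (if m = 0 then 1 else 0)) := by
  rcases eq_or_ne m 0 with rfl | hm
  · simp
  · rw [if_neg hm]
    have h := tendsto_inv_cosh_atTop.comp
      ((tendsto_two_pow_mul_atTop hs).const_mul_atTop (show (0 : ℝ) < |(m : ℝ)| by positivity))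
    refine h.congr fun k => ?_
    simp only [Function.comp_apply]
    rw [← cosh_abs (m * _), abs_mul, abs_of_pos (show 0 < 2 ^ k * s by positivity)]

lemma inv_cosh_int_mul_two_pow_le {s : ℝ} (hs : 0 < s) (m : ℤ) (k : ℕ) :
    (cosh (m * (2 ^ k * s)))⁻¹ ≤ (cosh (m * s))⁻¹ := by
  refine inv_anti₀ (cosh_pos _) (cosh_le_cosh.2 ?_)
  rw [abs_mul, abs_mul]
  refine mul_le_mul_of_nonneg_left ?_ (abs_nonneg _)
  rw [abs_of_pos hs, abs_of_pos (by positivity)]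
  exact le_mul_of_one_le_left hs.le (one_le_pow₀ one_le_two)

lemma tendsto_sechSum_zero {s : ℝ} (hs : 0 < s) :
    Tendsto (fun k : ℕ => sechSum 0 (2 ^ k * s)) atTop (𝓝 1) := by
  have h0 : Summable fun n : ℤ => (cosh (n * s))⁻¹ := by simpa using summable_inv_cosh 0 hs
  have h := tendsto_tsum_of_dominated_convergence h0 (tendsto_inv_cosh_int_mul hs)
    (Eventually.of_forall fun k m => by
      rw [norm_of_nonneg (inv_pos.2 (cosh_pos _)).le]
      exact inv_cosh_int_mul_two_pow_le hs m k)
  rw [tsum_ite_eq] at h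
  simpa only [sechSum, add_zero] using h

lemma tendsto_altSechSum {s : ℝ} (hs : 0 < s) :
    Tendsto (fun k : ℕ => altSechSum (2 ^ k * s)) atTop (𝓝 1) := by
  have h0 : Summable fun n : ℤ => (cosh (n * s))⁻¹ := by simpa using summable_inv_cosh 0 hs
  have h := tendsto_tsum_of_dominated_convergence (𝓕 := atTop)
    (f := fun (k : ℕ) (m : ℤ) => (-1 : ℝ) ^ m * (cosh (m * (2 ^ k * s)))⁻¹)
    (g := fun m : ℤ => (if m = 0 then 1 else 0)) h0 (fun m => by
      have := (tendsto_inv_cosh_int_mul hs m).const_mul ((-1 : ℝ) ^ m)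
      rcases eq_or_ne m 0 with rfl | hm
      · simp
      · simpa [hm] using this)
    (Eventually.of_forall fun k m => by
      rw [norm_neg_one_zpow_mul, norm_of_nonneg (inv_pos.2 (cosh_pos _)).le]
      exact inv_cosh_int_mul_two_pow_le hs m k)
  rwa [tsum_ite_eq] at h

/-- Positivity descends from `2t` to `t` through `L(t) M(t) = M(2t)²`, and it holds at `2 ^ k * s`
for some `k` because the limit there is 1. -/
lemma altSechSum_pos {s : ℝ} (hs : 0 < s) : 0 < altSechSum s := by
  have hstep : ∀ t : ℝ, 0 < t → 0 < altSechSum (2 * t) → 0 < altSechSum t := fun t ht h => by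
    have h1 := sechSum_zero_mul_altSechSum ht
    have h2 := one_le_sechSum_zero ht
    exact pos_of_mul_pos_right (h1 ▸ pow_pos h 2) (by linarith)
  have hpow : ∀ (k : ℕ) (t : ℝ), 0 < t → 0 < altSechSum (2 ^ k * t) → 0 < altSechSum t := by
    intro k
    induction k with
    | zero => intro t _ h; simpa using h
    | succ k ih =>
      intro t ht h
      exact hstep t ht (ih (2 * t) (by positivity) (by rwa [← mul_assoc, ← pow_succ]))
  obtain ⟨k, hk⟩ := ((tendsto_altSechSum hs).eventually (lt_mem_nhds one_pos)).exists
  exact hpow k s hs hk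

lemma sechSum_half_pos {s : ℝ} (hs : 0 < s) : 0 < sechSum (1 / 2) s :=
  lt_of_lt_of_le (by positivity) (sechSum_half_bounds hs).1

lemma sechSum_zero_pos {s : ℝ} (hs : 0 < s) : 0 < sechSum 0 s :=
  one_pos.trans_le (one_le_sechSum_zero hs)

lemma altSechSum_lt_sechSum_zero {s : ℝ} (hs : 0 < s) : altSechSum s < sechSum 0 s := by
  have h1 := sechSum_zero_sq hs
  have h2 := sechSum_half_pos hs
  refine lt_of_pow_lt_pow_left₀ 2 (sechSum_zero_pos hs).le ?_
  rw [h1]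
  linarith [pow_pos h2 2]

lemma sechSum_half_lt_sechSum_zero {s : ℝ} (hs : 0 < s) : sechSum (1 / 2) s < sechSum 0 s := by
  have h1 := sechSum_zero_sq hs
  have h2 := altSechSum_pos hs
  refine lt_of_pow_lt_pow_left₀ 2 (sechSum_zero_pos hs).le ?_
  rw [h1]
  linarith [pow_pos h2 2]

/-! ### Evaluation of the two Gauss integrals -/

lemma gaussIntegral_sechSum_altSechSum_double {s : ℝ} (hs : 0 < s) :
    gaussIntegral (sechSum 0 (2 * s)) (altSechSum (2 * s))
      = gaussIntegral (sechSum 0 s) (altSechSum s) := by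
  rw [← gaussIntegral_landen (sechSum_zero_pos hs) (altSechSum_pos hs),
    sechSum_zero_mul_altSechSum hs, sqrt_sq (altSechSum_pos (by positivity)).le,
    sechSum_zero_add_altSechSum hs, mul_div_cancel_left₀ _ two_ne_zero]

/-- The integer lattice sums of `sech`, plain and alternating, have arithmetic-geometric mean `1`. -/
theorem gaussIntegral_sechSum_altSechSum {s : ℝ} (hs : 0 < s) :
    gaussIntegral (sechSum 0 s) (altSechSum s) = π / 2 := by
  have hconst : ∀ k : ℕ, gaussIntegral (sechSum 0 (2 ^ k * s)) (altSechSum (2 ^ k * s))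
      = gaussIntegral (sechSum 0 s) (altSechSum s) := fun k => by
    induction k with
    | zero => simp
    | succ k ih => rw [pow_succ', mul_assoc, gaussIntegral_sechSum_altSechSum_double (by positivity), ih]
  have hb : ∀ k : ℕ, _ := fun k : ℕ =>
    gaussIntegral_bounds (altSechSum_pos (show 0 < 2 ^ k * s by positivity))
      (altSechSum_lt_sechSum_zero (by positivity)).le
  simp only [hconst] at hb
  have h1 := (tendsto_const_nhds (x := π / 2)).div (tendsto_sechSum_zero hs) one_ne_zero
  have h2 := (tendsto_const_nhds (x := π / 2)).div (tendsto_altSechSum hs) one_ne_zero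
  rw [div_one] at h1 h2
  exact le_antisymm (ge_of_tendsto' h2 fun k => (hb k).2) (le_of_tendsto' h1 fun k => (hb k).1)

lemma gaussIntegral_sechSum_double {s : ℝ} (hs : 0 < s) :
    gaussIntegral (sechSum 0 (2 * s)) (sechSum (1 / 2) (2 * s))
      = 2 * gaussIntegral (sechSum 0 s) (sechSum (1 / 2) s) := by
  have h2s : 0 < 2 * s := by positivity
  have h1 := sechSum_zero_add_altSechSum hs
  have h2 := sechSum_zero_sub_altSechSum hs
  have h3 := sechSum_zero_sq hs
  have h4 := sechSum_half_pos hs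
  rw [← gaussIntegral_landen (sechSum_zero_pos h2s) (sechSum_half_pos h2s),
    -- By duplication the product is `(L² - M²) / 4`, which the quadratic relation turns into `(N /
    -- 2)²`.
    show sechSum 0 (2 * s) * sechSum (1 / 2) (2 * s) = (1 / 2 * sechSum (1 / 2) s) ^ 2 by
      rw [show sechSum 0 (2 * s) = (sechSum 0 s + altSechSum s) / 2 by linarith,
        show sechSum (1 / 2) (2 * s) = (sechSum 0 s - altSechSum s) / 2 by linarith]
      linear_combination h3 / 4,
    sqrt_sq (by positivity),
    show (sechSum 0 (2 * s) + sechSum (1 / 2) (2 * s)) / 2 = 1 / 2 * sechSum 0 s by linarith,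
    gaussIntegral_mul one_half_pos]
  ring

lemma log_div_sechSum_half_bounds {s x : ℝ} (hs : 0 < s) (hx : 0 < x) :
    s / 2 + log x - log 4 + log (1 - exp (-s)) ≤ log (x / sechSum (1 / 2) s) ∧
      log (x / sechSum (1 / 2) s) ≤ s / 2 + log x - log 2 := by
  obtain ⟨h1, h2⟩ := sechSum_half_bounds hs
  have hN := sechSum_half_pos hs
  have he : 0 < 1 - exp (-s) := by
    rw [sub_pos, exp_lt_one_iff]
    linarith
  have h1' := log_le_log (by positivity) h1
  have h2' := log_le_log hN h2
  rw [log_mul (by positivity) (by positivity), log_exp] at h1'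
  rw [log_mul (by positivity) (by positivity), log_mul (by positivity) (by positivity), log_exp,
    log_inv] at h2'
  rw [log_div hx.ne' hN.ne']
  constructor <;> linarith

theorem gaussIntegral_sechSum_half {s : ℝ} (hs : 0 < s) :
    gaussIntegral (sechSum 0 s) (sechSum (1 / 2) s) = s / 2 := by
  have hscale : ∀ k : ℕ, gaussIntegral (sechSum 0 (2 ^ k * s)) (sechSum (1 / 2) (2 ^ k * s))
      = 2 ^ k * gaussIntegral (sechSum 0 s) (sechSum (1 / 2) s) := fun k => by
    induction k with
    | zero => simp
    | succ k ih => rw [pow_succ', mul_assoc, gaussIntegral_sechSum_double (by positivity), ih,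
        mul_assoc]
  set J := gaussIntegral (sechSum 0 s) (sechSum (1 / 2) s)
  have hk : ∀ k : ℕ, (0 : ℝ) < 2 ^ k := fun k => by positivity
  have hks : ∀ k : ℕ, 0 < 2 ^ k * s := fun k => by positivity
  have hL := tendsto_sechSum_zero hs
  have hM := tendsto_altSechSum hs
  have hpow : Tendsto (fun k : ℕ => (2 : ℝ) ^ k) atTop atTop :=
    tendsto_pow_atTop_atTop_of_one_lt one_lt_two
  have hlog : Tendsto (fun k : ℕ => log (sechSum 0 (2 ^ k * s) + altSechSum (2 ^ k * s))) atTop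
      (𝓝 (log (1 + 1))) := (hL.add hM).log (by norm_num)
  have hexp : Tendsto (fun k : ℕ => log (1 - exp (-(2 ^ k * s)))) atTop (𝓝 (log (1 - 0))) :=
    ((tendsto_exp_neg_atTop_nhds_zero.comp (tendsto_two_pow_mul_atTop hs)).const_sub 1).log
      (by norm_num)
  -- The logarithmic bounds at `2 ^ k * s`, divided by `2 ^ k`. Since `N` decays like `exp (-(2 ^ k
  -- * s) / 2)`, only `s / 2` survives in the limit.
  have hb : ∀ k : ℕ,
      (s / 2 + (log (sechSum 0 (2 ^ k * s) + altSechSum (2 ^ k * s)) - log 4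
        + log (1 - exp (-(2 ^ k * s)))) / 2 ^ k) / altSechSum (2 ^ k * s) ≤ J ∧
      J ≤ (s / 2 + (log (sechSum 0 (2 ^ k * s) + altSechSum (2 ^ k * s)) - log 2 + π / 2) / 2 ^ k)
        / altSechSum (2 ^ k * s) := fun k => by
    have hLk := sechSum_zero_pos (hks k)
    have hMk := altSechSum_pos (hks k)
    obtain ⟨h1, h2⟩ := gaussIntegral_log_bounds hLk (sechSum_half_pos (hks k)) hMk
      ((sechSum_zero_sq (hks k)).trans (add_comm _ _))
    obtain ⟨h3, h4⟩ := log_div_sechSum_half_bounds (hks k) (add_pos hLk hMk)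
    rw [hscale, div_le_iff₀ hMk] at h1
    rw [hscale, le_div_iff₀ hMk] at h2
    rw [div_le_iff₀ hMk, le_div_iff₀ hMk]
    have h2k := hk k
    constructor
    · rw [← mul_le_mul_iff_right₀ h2k, mul_add, mul_div_cancel₀ _ h2k.ne']
      linarith
    · rw [← mul_le_mul_iff_right₀ h2k, mul_add, mul_div_cancel₀ _ h2k.ne']
      linarith
  have hlow := ((((hlog.sub_const (log 4)).add hexp).div_atTop hpow).const_add (s / 2)).div hM
    one_ne_zero
  have hup := ((((hlog.sub_const (log 2)).add_const (π / 2)).div_atTop hpow).const_add (s / 2)).div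
    hM one_ne_zero
  rw [add_zero, div_one] at hlow hup
  exact le_antisymm (ge_of_tendsto' hup fun k => (hb k).2) (le_of_tendsto' hlow fun k => (hb k).1)

/-! ### The modulus as a quotient of lattice sums -/

lemma sqrt_one_sub_div_sq {a b c : ℝ} (ha : 0 < a) (hc : 0 < c) (h : a ^ 2 = c ^ 2 + b ^ 2) :
    √(1 - (b / a) ^ 2) = c / a := by
  rw [show 1 - (b / a) ^ 2 = (c / a) ^ 2 by field_simp; linarith, sqrt_sq (by positivity)]

lemma ellipticK_sechSum_ratio {s : ℝ} (hs : 0 < s) :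
    ellipticK (sechSum (1 / 2) s / sechSum 0 s) = sechSum 0 s * (π / 2) := by
  have hL := sechSum_zero_pos hs
  have hk : (sechSum (1 / 2) s / sechSum 0 s) ^ 2 ≤ 1 := pow_le_one₀
    (div_pos (sechSum_half_pos hs) hL).le ((div_le_one hL).2 (sechSum_half_lt_sechSum_zero hs).le)
  rw [ellipticK_eq_gaussIntegral hk, sqrt_one_sub_div_sq hL (altSechSum_pos hs) (sechSum_zero_sq hs),
    ← gaussIntegral_sechSum_altSechSum hs]
  have h := gaussIntegral_mul hL 1 (altSechSum s / sechSum 0 s)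
  rw [mul_one, mul_div_cancel₀ _ hL.ne'] at h
  rw [h, mul_div_cancel₀ _ hL.ne']

lemma ellipticK_sechSum_complementary {s : ℝ} (hs : 0 < s) :
    ellipticK √(1 - (sechSum (1 / 2) s / sechSum 0 s) ^ 2) = sechSum 0 s * (s / 2) := by
  have hL := sechSum_zero_pos hs
  have hk : (altSechSum s / sechSum 0 s) ^ 2 ≤ 1 := pow_le_one₀
    (div_pos (altSechSum_pos hs) hL).le ((div_le_one hL).2 (altSechSum_lt_sechSum_zero hs).le)
  rw [sqrt_one_sub_div_sq hL (altSechSum_pos hs) (sechSum_zero_sq hs),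
    ellipticK_eq_gaussIntegral hk, sqrt_one_sub_div_sq hL (sechSum_half_pos hs)
      ((sechSum_zero_sq hs).trans (add_comm _ _)), ← gaussIntegral_sechSum_half hs]
  have h := gaussIntegral_mul hL 1 (sechSum (1 / 2) s / sechSum 0 s)
  rw [mul_one, mul_div_cancel₀ _ hL.ne'] at h
  rw [h, mul_div_cancel₀ _ hL.ne']

/-- The modulus belonging to `r` is a quotient of lattice sums. -/
theorem isModulusOf_sechSum_ratio {r : ℝ} (hr : 0 < r) :
    IsModulusOf r (sechSum (1 / 2) (π * √r) / sechSum 0 (π * √r)) := by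
  have hs : 0 < π * √r := mul_pos pi_pos (sqrt_pos.2 hr)
  have hL := sechSum_zero_pos hs
  refine ⟨div_pos (sechSum_half_pos hs) hL, (div_lt_one hL).2 (sechSum_half_lt_sechSum_zero hs), ?_⟩
  rw [ellipticK_sechSum_complementary hs, ellipticK_sechSum_ratio hs,
    mul_div_mul_left _ _ hL.ne', div_div_div_cancel_right₀ two_ne_zero,
    mul_div_cancel_left₀ _ pi_ne_zero]

/-! ### The Lambert series over odd integers -/

/-- The odd natural numbers, enumerated as `2 * n + 1`. -/
def oddEquivNat : ℕ ≃ {n : ℕ // Odd n} where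
  toFun n := ⟨2 * n + 1, odd_two_mul_add_one n⟩
  invFun m := m / 2
  left_inv n := by simp; lia
  right_inv m := by
    obtain ⟨m, k, rfl⟩ := m
    ext
    simp
    lia

lemma exp_rpow_div_one_sub_pow (s : ℝ) (n : ℕ) :
    exp (-s) ^ (((2 * n + 1 : ℕ) : ℝ) / 2) / (1 - exp (-s) ^ (2 * n + 1))
      = 1 / sinh ((n + 1 / 2) * s) / 2 := by
  have h1 : exp (-s) ^ (((2 * n + 1 : ℕ) : ℝ) / 2) = exp (-((n + 1 / 2) * s)) := by
    rw [← exp_mul]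
    push_cast
    ring_nf
  have h2 : exp (-s) ^ (2 * n + 1) = exp (-((n + 1 / 2) * s)) * exp (-((n + 1 / 2) * s)) := by
    rw [← exp_nat_mul, ← exp_add]
    push_cast
    ring_nf
  rw [h1, h2, sinh_eq]
  generalize ((n : ℝ) + 1 / 2) * s = y
  have h3 : exp y - exp (-y) = (1 - exp (-y) * exp (-y)) * exp y := by
    rw [sub_mul, mul_assoc, ← exp_add, neg_add_cancel, exp_zero]
    ring
  rw [h3, exp_neg]
  have := exp_pos y
  -- No sign is assumed on `s`; when the denominator vanishes, both sides are 0 by the convention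
  -- for division by zero.
  rcases eq_or_ne (1 - (exp y)⁻¹ * (exp y)⁻¹) 0 with h0 | h0
  · simp [h0]
  · field_simp

lemma hasSum_odd_lambert {s : ℝ} (hs : 0 < s) :
    HasSum (fun n : {n : ℕ // Odd n} =>
      (-1 : ℝ) ^ (((n : ℕ) - 1) / 2) * exp (-s) ^ (((n : ℕ) : ℝ) / 2) / (1 - exp (-s) ^ (n : ℕ)))
      (sechSum (1 / 2) s / 4) := by
  rw [← oddEquivNat.hasSum_iff, show sechSum (1 / 2) s / 4 = sechSum (1 / 2) s / 2 / 2 by ring]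
  refine ((hasSum_alt_div_sinh hs).div_const 2).congr_fun fun n => ?_
  have h := exp_rpow_div_one_sub_pow s n
  simp only [Function.comp_apply, oddEquivNat, Equiv.coe_fn_mk, Nat.add_sub_cancel,
    Nat.mul_div_cancel_left n two_pos]
  rw [mul_div_assoc, h]
  ring

theorem theorem8 (r : ℝ) (hr : 0 < r) (q : ℝ) (hq : q = Real.exp (-(Real.pi * Real.sqrt r))) :
    (∃! k : ℝ, IsModulusOf r k) ∧
    ∀ k : ℝ, IsModulusOf r k →
      Summable (fun n : {n : ℕ // Odd n} =>
        (-1 : ℝ) ^ (((n : ℕ) - 1) / 2) * q ^ (((n : ℕ) : ℝ) / 2) / (1 - q ^ (n : ℕ))) ∧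
      Summable (fun n : ℕ =>
        (-1 : ℝ) ^ n / Real.sinh (((n : ℝ) + 1 / 2) * Real.pi * Real.sqrt r)) ∧
      2 * (∑' n : {n : ℕ // Odd n},
          (-1 : ℝ) ^ (((n : ℕ) - 1) / 2) * q ^ (((n : ℕ) : ℝ) / 2) / (1 - q ^ (n : ℕ)))
        = (∑' n : ℕ,
          (-1 : ℝ) ^ n / Real.sinh (((n : ℝ) + 1 / 2) * Real.pi * Real.sqrt r)) ∧
      (∑' n : ℕ,
          (-1 : ℝ) ^ n / Real.sinh (((n : ℝ) + 1 / 2) * Real.pi * Real.sqrt r))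
        = ellipticK k * k / Real.pi := by
  have hs : 0 < π * √r := mul_pos pi_pos (sqrt_pos.2 hr)
  have hmod := isModulusOf_sechSum_ratio hr
  refine ⟨⟨_, hmod, fun k hk => hk.unique hmod⟩, fun k hk => ?_⟩
  subst hq
  have h1 := hasSum_odd_lambert hs
  have h2 := hasSum_alt_div_sinh hs
  simp only [← mul_assoc] at h2
  refine ⟨h1.summable, h2.summable, ?_, ?_⟩
  · rw [h1.tsum_eq, h2.tsum_eq]
    ring
  · have hL := sechSum_zero_pos hs
    rw [h2.tsum_eq, hk.unique hmod, ellipticK_sechSum_ratio hs]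
    field_simp
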